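/- Let $M$ be a connected, paracompact, Hausdorff, finite-dimensional smooth ($C^\infty$) manifold without boundary, $\pi:TM\to M$ its tangent bundle, $\mathfrak X$ the set of smooth vector fields on $M$, and $\mathcal V=\ker(\pi_*:TTM\to TM)$ the vertical bundle. For $u\in T_pM$ let $\mathcal J_u:T_pM\to\mathcal V_u$, $\mathcal J_u w=\frac{d}{dt}\big|_{t=0}(u+tw)$, be the canonical isomorphism, and let $K:\mathcal V_u\to T_pM$ be its inverse. A (possibly nonlinear) connection on $TM$ is a smooth vector subbundle $\mathcal H$ of $TTM\to TM$ with $TTM=\mathcal H\oplus\mathcal V$. Let $H_v:T_vTM\to T_vTM$ be the projection onto $\mathcal H_v$ along $\mathcal V_v$, and let $\kappa(z)=K(z-H_vz)$ for $z\in T_vTM$. An operator $\nabla:\mathfrak X\times\mathfrak X\to\mathfrak X$ is associated to $\mathcal H$ if $\nabla_UV=\kappa(V_*U)$ for all $U,V\in\mathfrak X$, where $V$ is regarded as a map $M\to TM$; a (possibly nonlinear) covariant derivative is an operator $\nabla:\mathfrak X\times\mathfrak X\to\mathfrak X$ that is associated to some connection. Theorem. There is a bijection between the set of connections $\mathcal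 H$ on $TM$ and the set of covariant derivatives $\nabla$, which sends each $\mathcal H$ to a covariant derivative associated to it (in particular, $\kappa(V_*U)$ is a smooth vector field for all $U,V\in\mathfrak X$). Its inverse sends $\nabla$ to the connection $\bar{\mathcal H}$ with $$\bar{\mathcal H}_u=\{\,U_*v-\mathcal J_u\nabla_vU \mid U\in\mathfrak X,\ U_p=u,\ v\in T_pM\,\}\qquad(p\in M,\ u\in T_pM).$$ Every covariant derivative is tensorial in $U$: $\nabla_UV$ is $C^\infty(M)$-linear in $U$, and $(\nabla_UV)_p$ depends on $U$ only through $U_p$, so that $\nabla_vV:=(\nabla_UV)_p$ is well defined for $v=U_p$. It is in general nonlinear in $V$: if $\dim M\ge 1$, there are a covariant derivative $\nabla$ on $M$ and a $U\in\mathfrak X$ such that $V\mapsto\nabla_UV$ is not $\mathbb R$-linear. -/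

import Mathlib

open Bundle Set
open scoped Manifold ContDiff Topology

/-! Throughout, `M` is a smooth manifold without boundary modelled on a real normed space `E`,
`TM` is `TangentBundle 𝓘(ℝ, E) M`, and `T_v TM` is `TangentSpace 𝓘(ℝ, E).tangent v`. -/

noncomputable section

namespace NonlinearConnection

/-- Smooth vector fields on `M`. -/
abbrev VectorFields (E : Type*) [NormedAddCommGroup E] [NormedSpace ℝ E]
    (M : Type*) [TopologicalSpace M] [ChartedSpace E M] [IsManifold 𝓘(ℝ, E) ∞ M] :=
  Cₛ^∞⟮𝓘(ℝ, E); E, (TangentSpace 𝓘(ℝ, E) : M → Type _)⟯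

variable {E : Type*} [NormedAddCommGroup E] [NormedSpace ℝ E]
  {M : Type*} [TopologicalSpace M] [ChartedSpace E M] [IsManifold 𝓘(ℝ, E) ∞ M]

/-- A vector field as a map `M → TM`. -/
def toTM (V : VectorFields E M) (p : M) : TangentBundle 𝓘(ℝ, E) M := ⟨p, V p⟩

/-- The differential `V_* : T_p M → T_{V_p} TM` of a vector field regarded as a map `M → TM`. -/
def push (V : VectorFields E M) (p : M) :
    TangentSpace 𝓘(ℝ, E) p →L[ℝ] TangentSpace 𝓘(ℝ, E).tangent (toTM V p) :=
  mfderiv 𝓘(ℝ, E) 𝓘(ℝ, E).tangent (toTM V) p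

/-- The differential `π_* : T_v TM → T_{π v} M` of the projection `π : TM → M`. -/
def projDeriv (v : TangentBundle 𝓘(ℝ, E) M) :
    TangentSpace 𝓘(ℝ, E).tangent v →L[ℝ] TangentSpace 𝓘(ℝ, E) v.proj :=
  mfderiv 𝓘(ℝ, E).tangent 𝓘(ℝ, E) (TotalSpace.proj : TangentBundle 𝓘(ℝ, E) M → M) v

/-- The vertical space `𝒱_v = ker π_* ⊆ T_v TM`. -/
def vertical (v : TangentBundle 𝓘(ℝ, E) M) :
    Submodule ℝ (TangentSpace 𝓘(ℝ, E).tangent v) :=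
  LinearMap.ker (projDeriv v).toLinearMap

/-- The inclusion of the fibre `T_p M` in `TM`. (`TangentSpace 𝓘(ℝ, E) p` is by definition the
vector space `E`; it is written `E` here in order to have a manifold structure on it.) -/
def fiberIncl (p : M) : E → TangentBundle 𝓘(ℝ, E) M := fun w ↦ ⟨p, w⟩

/-- The canonical map `𝒥_u : T_{π u} M → T_u TM`, `w ↦ d/dt (u + t w) |_{t = 0}`, that is, the
differential at `u` of the inclusion of the fibre through `u`. -/
def vertLift (u : TangentBundle 𝓘(ℝ, E) M) :
    TangentSpace 𝓘(ℝ, E) u.proj →L[ℝ] TangentSpace 𝓘(ℝ, E).tangent u :=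
  mfderiv (M := E) 𝓘(ℝ, E) 𝓘(ℝ, E).tangent (fiberIncl u.proj) u.2

theorem hasMFDerivAt_fiberIncl (p : M) (y : E) :
    HasMFDerivAt 𝓘(ℝ, E) 𝓘(ℝ, E).tangent
      (fiberIncl p : E → TangentBundle 𝓘(ℝ, E) M) y (ContinuousLinearMap.inr ℝ E E) := by
  have key : ∀ w : E, extChartAt 𝓘(ℝ, E).tangent (fiberIncl p y)
      (fiberIncl p w : TangentBundle 𝓘(ℝ, E) M) = (extChartAt 𝓘(ℝ, E) p p, w) := by
    intro w
    refine Prod.ext rfl ?_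
    exact (tangentBundleCore 𝓘(ℝ, E) M).coordChange_self (achart E p) p (mem_achart_source E p) w
  constructor
  · exact (FiberBundle.continuous_totalSpaceMk E (TangentSpace 𝓘(ℝ, E)) p).continuousAt
  · have : writtenInExtChartAt 𝓘(ℝ, E) 𝓘(ℝ, E).tangent y
        (fiberIncl p : E → TangentBundle 𝓘(ℝ, E) M) =
        fun w => (extChartAt 𝓘(ℝ, E) p p, w) := by
      ext1 w
      exact key w
    rw [this]
    simp only [mfld_simps]
    exact ((hasFDerivAt_const _ _).prodMk (hasFDerivAt_id _)).hasFDerivWithinAt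

theorem hasMFDerivAt_proj (u : TangentBundle 𝓘(ℝ, E) M) :
    HasMFDerivAt 𝓘(ℝ, E).tangent 𝓘(ℝ, E)
      (TotalSpace.proj : TangentBundle 𝓘(ℝ, E) M → M) u (ContinuousLinearMap.fst ℝ E E) := by
  constructor
  · exact (FiberBundle.continuous_proj E _).continuousAt
  · refine HasFDerivWithinAt.congr_of_eventuallyEq
      (f := Prod.fst) hasFDerivAt_fst.hasFDerivWithinAt ?_ ?_
    · filter_upwards [mem_nhdsWithin_of_mem_nhds
        (extChartAt_target_mem_nhds (I := 𝓘(ℝ, E).tangent) u)] with z hz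
      have h0 : z ∈ (chartAt (ModelProd E E) u).target := by
        rw [extChartAt_target] at hz
        exact hz.1
      have h1 : z.1 ∈ (extChartAt 𝓘(ℝ, E) u.proj).target := by
        simpa only [mfld_simps] using (TangentBundle.mem_chart_target_iff z u).1 h0
      exact (extChartAt 𝓘(ℝ, E) u.proj).right_inv h1
    · exact (extChartAt 𝓘(ℝ, E) u.proj).right_inv (mem_extChartAt_target u.proj)

theorem vertLift_eq (u : TangentBundle 𝓘(ℝ, E) M) :
    vertLift u = ContinuousLinearMap.inr ℝ E E :=
  (hasMFDerivAt_fiberIncl (E := E) u.proj u.2).mfderiv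

theorem projDeriv_eq (u : TangentBundle 𝓘(ℝ, E) M) :
    projDeriv u = ContinuousLinearMap.fst ℝ E E :=
  (hasMFDerivAt_proj u).mfderiv

theorem vertLift_injective (u : TangentBundle 𝓘(ℝ, E) M) :
    Function.Injective (vertLift u) := by
  rw [vertLift_eq]
  exact fun a b h ↦ congrArg Prod.snd h

theorem range_vertLift (u : TangentBundle 𝓘(ℝ, E) M) :
    LinearMap.range (vertLift u).toLinearMap = vertical u := by
  rw [vertical, projDeriv_eq, vertLift_eq]
  exact LinearMap.range_inr ℝ E E

/-- The canonical isomorphism `𝒥_u : T_{π u} M ≃ 𝒱_u`. -/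
def vertLiftEquiv (u : TangentBundle 𝓘(ℝ, E) M) :
    TangentSpace 𝓘(ℝ, E) u.proj ≃ₗ[ℝ] vertical u :=
  (LinearEquiv.ofInjective (vertLift u).toLinearMap (vertLift_injective u)).trans
    (LinearEquiv.ofEq _ _ (range_vertLift u))

/-- The canonical isomorphism `K : 𝒱_u ≃ T_{π u} M`. -/
def vertK (u : TangentBundle 𝓘(ℝ, E) M) :
    vertical u ≃ₗ[ℝ] TangentSpace 𝓘(ℝ, E) u.proj :=
  (vertLiftEquiv u).symm

/-- A field of subspaces of the spaces `T_v TM` is a smooth subbundle of `TTM → TM`: around every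
point of `TM` it has a smooth frame. -/
def IsSmoothSubbundle
    (S : ∀ v : TangentBundle 𝓘(ℝ, E) M, Submodule ℝ (TangentSpace 𝓘(ℝ, E).tangent v)) : Prop :=
  ∀ v₀ : TangentBundle 𝓘(ℝ, E) M, ∃ O : Set (TangentBundle 𝓘(ℝ, E) M), IsOpen O ∧ v₀ ∈ O ∧
    ∃ (k : ℕ) (X : Fin k → ∀ v : TangentBundle 𝓘(ℝ, E) M, TangentSpace 𝓘(ℝ, E).tangent v),
      (∀ i, ContMDiffOn 𝓘(ℝ, E).tangent 𝓘(ℝ, E).tangent.tangent ∞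
        (fun v ↦ (⟨v, X i v⟩ : TangentBundle 𝓘(ℝ, E).tangent (TangentBundle 𝓘(ℝ, E) M))) O) ∧
      ∀ v ∈ O, LinearIndependent ℝ (fun i ↦ X i v) ∧
        Submodule.span ℝ (Set.range fun i ↦ X i v) = S v

variable (E M) in
/-- A (possibly nonlinear) connection on `TM`: a smooth subbundle `ℋ` of `TTM → TM` which is
complementary to the vertical bundle. -/
@[ext]
structure Connection where
  hor : ∀ v : TangentBundle 𝓘(ℝ, E) M, Submodule ℝ (TangentSpace 𝓘(ℝ, E).tangent v)
  isCompl : ∀ v, IsCompl (hor v) (vertical v)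
  smooth : IsSmoothSubbundle hor

namespace Connection

variable (H : Connection E M)

/-- The horizontal projection `H_v : T_v TM → T_v TM`, with image `ℋ_v` and kernel `𝒱_v`. -/
def horProj (v : TangentBundle 𝓘(ℝ, E) M) :
    TangentSpace 𝓘(ℝ, E).tangent v →ₗ[ℝ] TangentSpace 𝓘(ℝ, E).tangent v :=
  (H.hor v).projection (vertical v) (H.isCompl v)

theorem sub_horProj_mem (v : TangentBundle 𝓘(ℝ, E) M) (z : TangentSpace 𝓘(ℝ, E).tangent v) :
    z - H.horProj v z ∈ vertical v :=
  Submodule.sub_projection_mem (H.isCompl v) z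

/-- The connector `κ(z) = K (z - H_v z)` for `z ∈ T_v TM`. -/
def connector (v : TangentBundle 𝓘(ℝ, E) M) (z : TangentSpace 𝓘(ℝ, E).tangent v) :
    TangentSpace 𝓘(ℝ, E) v.proj :=
  vertK v ⟨z - H.horProj v z, H.sub_horProj_mem v z⟩

/-- The operator `D` is the covariant derivative associated to `H`: `D_U V = κ(V_* U)`. -/
def IsAssociated (D : VectorFields E M → VectorFields E M → VectorFields E M) : Prop :=
  ∀ (U V : VectorFields E M) (p : M), D U V p = H.connector (toTM V p) (push V p (U p))

end Connection

variable (E M) in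
/-- The (possibly nonlinear) covariant derivatives on `TM`: the operators `(U, V) ↦ D_U V` on smooth
vector fields which are associated to some connection. -/
def NonlinearCovariantDerivative : Type _ :=
  {D : VectorFields E M → VectorFields E M → VectorFields E M //
    ∃ H : Connection E M, H.IsAssociated D}

/-- The set `{U_* v - 𝒥_u D_v U | U ∈ 𝔛, U_p = u, v ∈ T_p M}`, where `p = π u`. The vector `v` is
written as the value at `p` of a vector field `V`, and `D_v U` is `(D_V U)_p`. The equality in `TTM`
says that `U_p = u` and `z = U_* v - 𝒥_u D_v U`. -/
def reconstruct (D : VectorFields E M → VectorFields E M → VectorFields E M)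
    (u : TangentBundle 𝓘(ℝ, E) M) : Set (TangentSpace 𝓘(ℝ, E).tangent u) :=
  {z | ∃ U V : VectorFields E M,
    (⟨u, z⟩ : TangentBundle 𝓘(ℝ, E).tangent (TangentBundle 𝓘(ℝ, E) M)) =
      ⟨toTM U u.proj, push U u.proj (V u.proj) - vertLift (toTM U u.proj) (D V U u.proj)⟩}

/-- `D_U V` is tensorial in `U`: it is linear over the smooth functions, and its value at `p`
depends on `U` only through `U_p` (so that `D_v V` makes sense for a single vector `v`). -/
def IsTensorialInDirection (D : VectorFields E M → VectorFields E M → VectorFields E M) : Prop :=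
  (∀ (f g : C^∞⟮𝓘(ℝ, E), M; 𝓘(ℝ, ℝ), ℝ⟯) (U U' W V : VectorFields E M),
    (∀ p, W p = f p • U p + g p • U' p) → ∀ p, D W V p = f p • D U V p + g p • D U' V p) ∧
  ∀ (U U' V : VectorFields E M) (p : M), U p = U' p → D U V p = D U' V p

end NonlinearConnection

end

/-! The value `κ(z)` is the unique `w` for which `z - 𝒥 w` is horizontal
(`Connection.connector_eq_of_sub_mem`). Hence `U_* v - 𝒥 ∇_v U` always lies in `ℋ`, and it projects
to `v` because `U` is a section of `π`. As `π_*` is injective on `ℋ_u`, a horizontal vector is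
determined by its projection; bump functions provide vector fields with any prescribed value at a
point, so these vectors exhaust `ℋ_u`. Thus `∇` determines `ℋ` (`reconstruct_eq`), and surjectivity
onto the covariant derivatives holds by their definition.

Smoothness of `κ(V_* U)` is local linear algebra: in a chart, a frame of `ℋ` together with the
vertical directions gives a smoothly varying invertible map (`frameMap`), and `κ` is a component of
its inverse.

For nonlinearity, connections are encoded as smooth fields `P` of projectors onto `𝒱`, with `ℋ = ker
P`. Such fields form an affine space, so a partition of unity supplies one; this is where
σ-compactness enters. Adding to `P` the endomorphism `𝒥 ∘ π_*` scaled by the fibrewise quadratic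
function `(df)²` changes `∇_U V` by `(df V)² U`. The two covariant derivatives cannot both be linear
in `V`. -/

/-! ### Topology of `M` and `TM`; vector fields with prescribed values -/

/-- A connected, paracompact, locally compact Hausdorff space is σ-compact. -/
theorem sigmaCompactSpace_of_connected_of_paracompact {X : Type*} [TopologicalSpace X]
    [ConnectedSpace X] [ParacompactSpace X] [LocallyCompactSpace X] [T2Space X] :
    SigmaCompactSpace X := by
  choose N hNc hN using fun x : X ↦ exists_compact_mem_nhds x
  obtain ⟨t, ht, htU, htf, htN⟩ := precise_refinement (fun x ↦ interior (N x))
    (fun _ ↦ isOpen_interior) (iUnion_eq_univ_iff.2 fun x ↦ ⟨x, mem_interior_iff_mem_nhds.2 (hN x)⟩)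
  have htc (i : X) : IsCompact (closure (t i)) :=
    (hNc i).of_isClosed_subset isClosed_closure
      (closure_minimal ((htN i).trans interior_subset) (hNc i).isClosed)
  obtain ⟨x₀⟩ := (inferInstance : Nonempty X)
  -- Grow a compact set from `x₀`: each stage is the union of the closures of the members that meet
  -- the previous one. By local finiteness only finitely many do.
  let K : ℕ → Set X := fun n ↦ n.rec {x₀} fun _ A ↦ ⋃ i ∈ {i | (t i ∩ A).Nonempty}, closure (t i)
  have hKsucc (n : ℕ) : K (n + 1) = ⋃ i ∈ {i | (t i ∩ K n).Nonempty}, closure (t i) := rfl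
  have hK (n : ℕ) : IsCompact (K n) := by
    induction n with
    | zero => exact isCompact_singleton
    | succ n ih =>
      rw [hKsucc]
      exact (htf.finite_nonempty_inter_compact ih).isCompact_biUnion fun i _ ↦ htc i
  have hsub {n : ℕ} {i : X} (h : (t i ∩ K n).Nonempty) : t i ⊆ K (n + 1) := fun x hx ↦ by
    rw [hKsucc]
    exact mem_biUnion (show i ∈ {i | (t i ∩ K n).Nonempty} from h) (subset_closure hx)
  have hcover (x : X) : ∃ i, x ∈ t i := iUnion_eq_univ_iff.1 htU x
  have hclopen : IsClopen (⋃ n, K n) := by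
    constructor
    -- A member around a limit point meets some `K n`, hence lies in `K (n + 1)`.
    · refine isClosed_of_closure_subset fun x hx ↦ ?_
      obtain ⟨i, hi⟩ := hcover x
      obtain ⟨y, hyt, hy⟩ := mem_closure_iff.1 hx (t i) (ht i) hi
      obtain ⟨n, hn⟩ := mem_iUnion.1 hy
      exact mem_iUnion.2 ⟨n + 1, hsub ⟨y, hyt, hn⟩ hi⟩
    · refine isOpen_iff_mem_nhds.2 fun x hx ↦ ?_
      obtain ⟨n, hn⟩ := mem_iUnion.1 hx
      obtain ⟨i, hi⟩ := hcover x
      exact Filter.mem_of_superset ((ht i).mem_nhds hi)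
        ((hsub ⟨x, hi, hn⟩).trans (subset_iUnion K (n + 1)))
  exact ⟨K, hK, hclopen.eq_univ ⟨x₀, mem_iUnion.2 ⟨0, rfl⟩⟩⟩

namespace NonlinearConnection

variable {E : Type*} [NormedAddCommGroup E] [NormedSpace ℝ E]
  {M : Type*} [TopologicalSpace M] [ChartedSpace E M] [IsManifold 𝓘(ℝ, E) ∞ M]

/-- The tangent bundle of a Hausdorff manifold is Hausdorff. -/
theorem t2Space_tangentBundle [T2Space M] : T2Space (TangentBundle 𝓘(ℝ, E) M) := by
  refine ⟨fun u v huv ↦ ?_⟩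
  have hπ : Continuous (TotalSpace.proj : TangentBundle 𝓘(ℝ, E) M → M) :=
    FiberBundle.continuous_proj E _
  by_cases h : u.proj = v.proj
  -- Two vectors in the same fibre share a chart of `TM`, since its domain is a full preimage under
  -- `π`.
  · let c := chartAt (ModelProd E E) u
    have hu : u ∈ c.source := mem_chart_source _ u
    have hv : v ∈ c.source := by
      rw [TangentBundle.mem_chart_source_iff, ← h]
      exact mem_chart_source E u.proj
    obtain ⟨A, B, hA, hB, hAu, hBv, hAB⟩ := t2_separation (X := E × E) (c.injOn.ne hu hv huv)
    exact ⟨c.source ∩ c ⁻¹' A, c.source ∩ c ⁻¹' B, c.isOpen_inter_preimage hA,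
      c.isOpen_inter_preimage hB, ⟨hu, hAu⟩, ⟨hv, hBv⟩,
      (hAB.preimage c).mono inter_subset_right inter_subset_right⟩
  · obtain ⟨A, B, hA, hB, hAu, hBv, hAB⟩ := t2_separation h
    exact ⟨_, _, hA.preimage hπ, hB.preimage hπ, hAu, hBv, hAB.preimage _⟩

/-- The tangent bundle of a σ-compact finite-dimensional manifold is σ-compact. -/
theorem sigmaCompactSpace_tangentBundle [FiniteDimensional ℝ E] [SigmaCompactSpace M] :
    SigmaCompactSpace (TangentBundle 𝓘(ℝ, E) M) := by
  obtain ⟨s, hs, hsU⟩ := countable_cover_nhds_of_sigmaCompact fun x : M ↦ chart_source_mem_nhds E x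
  have : ProperSpace E := FiniteDimensional.proper ℝ E
  have : SecondCountableTopology (ModelProd E E) :=
    inferInstanceAs (SecondCountableTopology (E × E))
  have : SecondCountableTopology (TangentBundle 𝓘(ℝ, E) M) := by
    -- The chart domain at a vector depends only on its base point, so the zero vectors over `s`
    -- suffice as centres.
    refine ChartedSpace.secondCountable_of_countable_cover (ModelProd E E)
      (s := (fun x ↦ (⟨x, 0⟩ : TangentBundle 𝓘(ℝ, E) M)) '' s) ?_ (hs.image _)
    refine eq_univ_of_forall fun u ↦ ?_
    obtain ⟨x, hx, hux⟩ := mem_iUnion₂.1 (hsU.symm ▸ mem_univ u.proj : u.proj ∈ _)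
    refine mem_iUnion₂.2 ⟨_, mem_image_of_mem _ hx, ?_⟩
    rwa [TangentBundle.mem_chart_source_iff]
  have : LocallyCompactSpace (TangentBundle 𝓘(ℝ, E) M) :=
    Manifold.locallyCompact_of_finiteDimensional 𝓘(ℝ, E).tangent
  infer_instance

/-- Every tangent vector is the value of a smooth vector field. -/
theorem exists_vectorField_eq [FiniteDimensional ℝ E] [T2Space M] (p : M)
    (v : TangentSpace 𝓘(ℝ, E) p) : ∃ V : VectorFields E M, V p = v := by
  obtain ⟨f⟩ : Nonempty (SmoothBumpFunction 𝓘(ℝ, E) p) := inferInstance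
  let e := trivializationAt E (TangentSpace 𝓘(ℝ, E) : M → Type _) p
  have hp : p ∈ e.baseSet := FiberBundle.mem_baseSet_trivializationAt' p
  have hs : ContMDiffOn 𝓘(ℝ, E) (𝓘(ℝ, E).prod 𝓘(ℝ, E)) ∞
      (fun x ↦ TotalSpace.mk' E x (e.symm x (e ⟨p, v⟩).2)) e.baseSet := by
    rw [e.contMDiffOn_section_baseSet_iff]
    refine contMDiffOn_const (c := (e ⟨p, v⟩).2) |>.congr fun x hx ↦ ?_
    rw [e.apply_mk_symm hx]
  -- The section with constant coordinates near `p` is cut off by a bump function supported in the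
  -- chart.
  have := ContMDiffOn.smul_section_of_tsupport (f.contMDiff.contMDiffOn) e.open_baseSet
    f.tsupport_subset_chartAt_source hs
  refine ⟨⟨_, this⟩, ?_⟩
  change f p • e.symm p (e ⟨p, v⟩).2 = v
  rw [f.eq_one, one_smul, e.symm_apply_apply_mk hp]

/-! ### Chart coordinates on `TM` and `TTM` -/

noncomputable section

variable (M) in
/-- The coordinates on `T_x M` given by the chart of `M` at `x₀`. -/
def coord (x₀ x : M) : TangentSpace 𝓘(ℝ, E) x →L[ℝ] E :=
  (trivializationAt E (TangentSpace 𝓘(ℝ, E)) x₀).continuousLinearMapAt ℝ x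

/-- The coordinates on `T_u TM` given by the chart of `TM` at `u₀`. -/
def coordT (u₀ u : TangentBundle 𝓘(ℝ, E) M) : TangentSpace 𝓘(ℝ, E).tangent u →L[ℝ] E × E :=
  (trivializationAt (E × E) (TangentSpace 𝓘(ℝ, E).tangent) u₀).continuousLinearMapAt ℝ u

end

theorem coord_apply {x₀ x : M} (hx : x ∈ (chartAt E x₀).source) (w : TangentSpace 𝓘(ℝ, E) x) :
    coord M x₀ x w = (trivializationAt E (TangentSpace 𝓘(ℝ, E)) x₀ ⟨x, w⟩).2 := by
  rw [coord, Trivialization.continuousLinearMapAt_apply, Trivialization.coe_linearMapAt_of_mem]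
  exact hx

theorem coordT_apply {u₀ u : TangentBundle 𝓘(ℝ, E) M} (hu : u.proj ∈ (chartAt E u₀.proj).source)
    (z : TangentSpace 𝓘(ℝ, E).tangent u) :
    coordT u₀ u z =
      (trivializationAt (E × E) (TangentSpace 𝓘(ℝ, E).tangent) u₀ ⟨u, z⟩).2 := by
  rw [coordT, Trivialization.continuousLinearMapAt_apply, Trivialization.coe_linearMapAt_of_mem]
  rwa [TangentBundle.trivializationAt_baseSet, TangentBundle.mem_chart_source_iff]

theorem coord_bijective {x₀ x : M} (hx : x ∈ (chartAt E x₀).source) :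
    Function.Bijective (coord (E := E) M x₀ x) := by
  rw [show ⇑(coord (E := E) M x₀ x) = _ from funext (coord_apply hx)]
  exact ((trivializationAt E (TangentSpace 𝓘(ℝ, E)) x₀).continuousLinearEquivAt ℝ x hx).bijective

theorem coordT_bijective {u₀ u : TangentBundle 𝓘(ℝ, E) M}
    (hu : u.proj ∈ (chartAt E u₀.proj).source) : Function.Bijective (coordT u₀ u) := by
  rw [show ⇑(coordT u₀ u) = _ from funext (coordT_apply hu)]
  have hu' : u ∈ (trivializationAt (E × E) (TangentSpace 𝓘(ℝ, E).tangent) u₀).baseSet := by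
    rwa [TangentBundle.trivializationAt_baseSet, TangentBundle.mem_chart_source_iff]
  exact ((trivializationAt (E × E) (TangentSpace 𝓘(ℝ, E).tangent) u₀).continuousLinearEquivAt
    ℝ u hu').bijective

/-- Trivializing the tangent bundle is differentiating the chart, so maps can be put in coordinates
by the chain rule and uniqueness of derivatives. -/
theorem hasMFDerivAt_extChartAt_coord {x₀ x : M} (hx : x ∈ (chartAt E x₀).source) :
    HasMFDerivAt 𝓘(ℝ, E) 𝓘(ℝ, E) (extChartAt 𝓘(ℝ, E) x₀) x (coord (E := E) M x₀ x) := by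
  rw [coord, TangentBundle.continuousLinearMapAt_trivializationAt hx]
  exact (mdifferentiableAt_extChartAt hx).hasMFDerivAt

theorem hasMFDerivAt_extChartAt_coordT {u₀ u : TangentBundle 𝓘(ℝ, E) M}
    (hu : u.proj ∈ (chartAt E u₀.proj).source) :
    HasMFDerivAt 𝓘(ℝ, E).tangent 𝓘(ℝ, E × E) (extChartAt 𝓘(ℝ, E).tangent u₀) u (coordT u₀ u) := by
  have hu' : u ∈ (chartAt (ModelProd E E) u₀).source := by
    rwa [TangentBundle.mem_chart_source_iff]
  rw [coordT, TangentBundle.continuousLinearMapAt_trivializationAt hu']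
  exact (mdifferentiableAt_extChartAt hu').hasMFDerivAt

/-- Vertical lifts in coordinates. -/
theorem coordT_vertLift {u₀ u : TangentBundle 𝓘(ℝ, E) M}
    (hu : u.proj ∈ (chartAt E u₀.proj).source) (w : TangentSpace 𝓘(ℝ, E) u.proj) :
    coordT u₀ u (vertLift u w) = (0, coord M u₀.proj u.proj w) := by
  let y : E := u.2
  let A : E →L[ℝ] E := coord M u₀.proj u.proj
  have h1 := HasMFDerivAt.comp (I := 𝓘(ℝ, E)) (I' := 𝓘(ℝ, E).tangent) (I'' := 𝓘(ℝ, E × E)) y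
    (hasMFDerivAt_extChartAt_coordT hu) (hasMFDerivAt_fiberIncl u.proj y)
  -- In the charts the fibre inclusion has constant first component and linear second component.
  have h2 : (extChartAt 𝓘(ℝ, E).tangent u₀ ∘
      (fiberIncl u.proj : E → TangentBundle 𝓘(ℝ, E) M)) =
      fun w ↦ (extChartAt 𝓘(ℝ, E) u₀.proj u.proj, A w) := by
    funext w
    refine Prod.ext rfl ?_
    exact (coord_apply hu w).symm
  rw [h2] at h1
  have h3 : HasFDerivAt (fun w : E ↦ (extChartAt 𝓘(ℝ, E) u₀.proj u.proj, A w))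
      ((0 : E →L[ℝ] E).prod A) y :=
    (hasFDerivAt_const _ _).prodMk A.hasFDerivAt
  rw [vertLift_eq]
  exact congrArg (fun L : E →L[ℝ] E × E ↦ L w) (hasMFDerivAt_unique h1 h3.hasMFDerivAt)

/-- The differential of the projection in coordinates. -/
theorem coordT_fst {u₀ u : TangentBundle 𝓘(ℝ, E) M}
    (hu : u.proj ∈ (chartAt E u₀.proj).source) (z : TangentSpace 𝓘(ℝ, E).tangent u) :
    (coordT u₀ u z).1 = coord M u₀.proj u.proj (projDeriv u z) := by
  have h1 := HasMFDerivAt.comp (I := 𝓘(ℝ, E).tangent) (I' := 𝓘(ℝ, E × E)) (I'' := 𝓘(ℝ, E))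
    (g := (Prod.fst : E × E → E)) u hasFDerivAt_fst.hasMFDerivAt (hasMFDerivAt_extChartAt_coordT hu)
  have h2 := HasMFDerivAt.comp (I := 𝓘(ℝ, E).tangent) (I' := 𝓘(ℝ, E)) (I'' := 𝓘(ℝ, E)) u
    (hasMFDerivAt_extChartAt_coord hu) (hasMFDerivAt_proj u)
  rw [projDeriv_eq]
  -- The chart of `TM` covers that of `M`: `h1` and `h2` differentiate the same map.
  exact congrArg (fun L : E × E →L[ℝ] E ↦ L z) (hasMFDerivAt_unique h1 h2)

/-! ### Algebra of the connector -/

section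

theorem vertLift_mem_vertical (u : TangentBundle 𝓘(ℝ, E) M) (w : TangentSpace 𝓘(ℝ, E) u.proj) :
    vertLift u w ∈ vertical u := by
  rw [← range_vertLift]
  exact ⟨w, rfl⟩

theorem vertLift_vertK (u : TangentBundle 𝓘(ℝ, E) M) (z : vertical u) :
    vertLift u (vertK u z) = z :=
  congrArg Subtype.val ((vertLiftEquiv u).apply_symm_apply z)

theorem projDeriv_vertLift (u : TangentBundle 𝓘(ℝ, E) M) (w : TangentSpace 𝓘(ℝ, E) u.proj) :
    projDeriv u (vertLift u w) = 0 :=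
  vertLift_mem_vertical u w

theorem contMDiff_toTM (V : VectorFields E M) :
    ContMDiff 𝓘(ℝ, E) 𝓘(ℝ, E).tangent ∞ (toTM V) :=
  V.contMDiff

/-- `V` is a section of `π`. -/
theorem projDeriv_push (V : VectorFields E M) (p : M) (v : TangentSpace 𝓘(ℝ, E) p) :
    projDeriv (toTM V p) (push V p v) = v := by
  have hV : MDifferentiableAt 𝓘(ℝ, E) 𝓘(ℝ, E).tangent (toTM V) p :=
    (contMDiff_toTM V p).mdifferentiableAt (by simp)
  have h1 := HasMFDerivAt.comp (I := 𝓘(ℝ, E)) (I' := 𝓘(ℝ, E).tangent) (I'' := 𝓘(ℝ, E)) p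
    (hasMFDerivAt_proj (toTM V p)) hV.hasMFDerivAt
  have h2 : HasMFDerivAt 𝓘(ℝ, E) 𝓘(ℝ, E)
    ((TotalSpace.proj : TangentBundle 𝓘(ℝ, E) M → M) ∘ toTM V) p _ := hasMFDerivAt_id p
  rw [projDeriv_eq]
  exact congrArg (fun L : E →L[ℝ] E ↦ L v) (hasMFDerivAt_unique h1 h2)

namespace Connection

variable (H : Connection E M)

theorem horProj_mem (v : TangentBundle 𝓘(ℝ, E) M) (z : TangentSpace 𝓘(ℝ, E).tangent v) :
    H.horProj v z ∈ H.hor v :=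
  Submodule.projection_apply_mem (H.isCompl v) z

theorem vertLift_connector (v : TangentBundle 𝓘(ℝ, E) M) (z : TangentSpace 𝓘(ℝ, E).tangent v) :
    vertLift v (H.connector v z) = z - H.horProj v z :=
  vertLift_vertK v _

theorem sub_vertLift_connector_mem (v : TangentBundle 𝓘(ℝ, E) M)
    (z : TangentSpace 𝓘(ℝ, E).tangent v) : z - vertLift v (H.connector v z) ∈ H.hor v := by
  rw [vertLift_connector, sub_sub_cancel]
  exact H.horProj_mem v z

theorem eq_zero_of_mem_of_mem {v : TangentBundle 𝓘(ℝ, E) M} {z : TangentSpace 𝓘(ℝ, E).tangent v}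
    (h : z ∈ H.hor v) (h' : z ∈ vertical v) : z = 0 :=
  Submodule.disjoint_def.1 (H.isCompl v).disjoint z h h'

/-- Two such `w` have lifts that differ by a vector both horizontal and vertical, hence zero. -/
theorem connector_eq_of_sub_mem {v : TangentBundle 𝓘(ℝ, E) M}
    {z : TangentSpace 𝓘(ℝ, E).tangent v} {w : TangentSpace 𝓘(ℝ, E) v.proj}
    (h : z - vertLift v w ∈ H.hor v) : H.connector v z = w := by
  apply vertLift_injective v
  have h1 := (H.hor v).sub_mem h (H.sub_vertLift_connector_mem v z)
  rw [sub_sub_sub_cancel_left] at h1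
  exact sub_eq_zero.1 (H.eq_zero_of_mem_of_mem h1
    ((vertical v).sub_mem (vertLift_mem_vertical v _) (vertLift_mem_vertical v _)))

theorem connector_add_smul (v : TangentBundle 𝓘(ℝ, E) M) (a b : ℝ)
    (z z' : TangentSpace 𝓘(ℝ, E).tangent v) :
    H.connector v (a • z + b • z') = a • H.connector v z + b • H.connector v z' := by
  apply vertLift_injective v
  simp only [map_add, map_smul, vertLift_connector, smul_sub]
  abel

end Connection

/-! ### Smoothness of `κ(V_* U)` -/

/-- In coordinates, the map that sends `(c, w)` to the linear combination of the frame `x` with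
coefficients `c` plus the vertical vector `(0, w)`. -/
noncomputable def frameMap {k : ℕ} (x : Fin k → E × E) : (Fin k → ℝ) × E →L[ℝ] E × E :=
  ∑ i, ContinuousLinearMap.smulRightL ℝ _ _
      ((ContinuousLinearMap.proj i).comp (ContinuousLinearMap.fst ℝ (Fin k → ℝ) E)) (x i) +
    (ContinuousLinearMap.inr ℝ E E).comp (ContinuousLinearMap.snd ℝ (Fin k → ℝ) E)

theorem frameMap_apply {k : ℕ} (x : Fin k → E × E) (c : Fin k → ℝ) (w : E) :
    frameMap x (c, w) = ∑ i, c i • x i + (0, w) := by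
  simp [frameMap]

theorem contMDiffAt_frameMap {N : Type*} [TopologicalSpace N] [ChartedSpace E N] {k : ℕ}
    {x : N → Fin k → E × E} {p : N}
    (hx : ∀ i, ContMDiffAt 𝓘(ℝ, E) 𝓘(ℝ, E × E) ∞ (fun q ↦ x q i) p) :
    ContMDiffAt 𝓘(ℝ, E) 𝓘(ℝ, (Fin k → ℝ) × E →L[ℝ] E × E) ∞ (fun q ↦ frameMap (x q)) p := by
  refine ContMDiffAt.add (contMDiffAt_finsetSum fun i _ ↦ ?_) contMDiffAt_const
  exact ContMDiffAt.comp p (ContinuousLinearMap.contMDiff _).contMDiffAt (hx i)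

theorem Connection.IsAssociated.isTensorialInDirection {H : Connection E M}
    {D : VectorFields E M → VectorFields E M → VectorFields E M} (h : H.IsAssociated D) :
    IsTensorialInDirection D := by
  refine ⟨fun f g U U' W V hW p ↦ ?_, fun U U' V p hU ↦ ?_⟩
  · rw [h, h, h, hW, map_add, map_smul, map_smul, connector_add_smul]
    rfl
  · rw [h, h, hU]

/-- Splitting `z` into horizontal and vertical parts shows that `κ(z)`, in coordinates, is the last
component of a preimage of `z` under the frame map. -/
theorem Connection.exists_frameMap_eq (H : Connection E M) {u₀ u : TangentBundle 𝓘(ℝ, E) M}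
    (hu : u.proj ∈ (chartAt E u₀.proj).source) {k : ℕ}
    {X : Fin k → TangentSpace 𝓘(ℝ, E).tangent u}
    (hspan : Submodule.span ℝ (range X) = H.hor u) (z : TangentSpace 𝓘(ℝ, E).tangent u) :
    ∃ c, frameMap (fun i ↦ coordT u₀ u (X i)) (c, coord M u₀.proj u.proj (H.connector u z)) =
      coordT u₀ u z := by
  have h := H.sub_vertLift_connector_mem u z
  rw [← hspan, Submodule.mem_span_range_iff_exists_fun] at h
  obtain ⟨c, hc⟩ := h
  refine ⟨c, ?_⟩
  rw [frameMap_apply, ← coordT_vertLift hu]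
  calc _ = coordT u₀ u (∑ i, c i • X i + vertLift u (H.connector u z)) := by
        simp only [map_add, map_sum, map_smul]
    _ = coordT u₀ u z := by rw [hc, sub_add_cancel]

variable [FiniteDimensional ℝ E]

/-- Surjectivity is `ℋ + 𝒱 = T_u TM`; injectivity is `ℋ ∩ 𝒱 = 0` together with independence of the
frame. -/
theorem Connection.frameMap_isInvertible (H : Connection E M) {u₀ u : TangentBundle 𝓘(ℝ, E) M}
    (hu : u.proj ∈ (chartAt E u₀.proj).source) {k : ℕ}
    {X : Fin k → TangentSpace 𝓘(ℝ, E).tangent u} (hX : LinearIndependent ℝ X)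
    (hspan : Submodule.span ℝ (range X) = H.hor u) :
    (frameMap fun i ↦ coordT u₀ u (X i)).IsInvertible := by
  have hsurj : Function.Surjective (frameMap fun i ↦ coordT u₀ u (X i)) := fun y ↦ by
    obtain ⟨z, rfl⟩ := (coordT_bijective hu).2 y
    obtain ⟨c, hc⟩ := H.exists_frameMap_eq hu hspan z
    exact ⟨_, hc⟩
  have hinj : Function.Injective (frameMap fun i ↦ coordT u₀ u (X i)) := by
    rw [injective_iff_map_eq_zero]
    rintro ⟨c, w⟩ h
    obtain ⟨w, rfl⟩ := (coord_bijective hu).2 w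
    rw [frameMap_apply, ← coordT_vertLift hu] at h
    have h' : ∑ i, c i • X i + vertLift u w = 0 := (coordT_bijective hu).1 (by simpa using h)
    have hmem : ∑ i, c i • X i ∈ H.hor u := by
      rw [← hspan]
      exact Submodule.mem_span_range_iff_exists_fun ℝ |>.2 ⟨c, rfl⟩
    have h0 : ∑ i, c i • X i = 0 := by
      refine H.eq_zero_of_mem_of_mem hmem ?_
      rw [eq_neg_of_add_eq_zero_left h']
      exact (vertical u).neg_mem (vertLift_mem_vertical u w)
    have hc : c = 0 := funext (Fintype.linearIndependent_iff.1 hX c h0)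
    rw [h0, zero_add] at h'
    have hw : w = 0 := vertLift_injective u (h'.trans (map_zero _).symm)
    simp [hc, hw]
  exact ⟨.ofBijective _ (LinearMap.ker_eq_bot.2 hinj) (LinearMap.range_eq_top.2 hsurj), rfl⟩

/-- `κ(V_* U)` is a smooth vector field. -/
theorem Connection.contMDiff_connector_push (H : Connection E M) (U V : VectorFields E M) :
    ContMDiff 𝓘(ℝ, E) (𝓘(ℝ, E).prod 𝓘(ℝ, E)) ∞
      fun p ↦ TotalSpace.mk' E (E := (TangentSpace 𝓘(ℝ, E) : M → Type _)) p
        (H.connector (toTM V p) (push V p (U p))) := by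
  intro p₀
  obtain ⟨O, hO, hvO, k, X, hXs, hX⟩ := H.smooth (toTM V p₀)
  -- `p ↦ V_* U_p` is the tangent map of `V` composed with `U`.
  have hz : ContMDiff 𝓘(ℝ, E) 𝓘(ℝ, E).tangent.tangent ∞ (fun p ↦
      (⟨toTM V p, push V p (U p)⟩ : TangentBundle 𝓘(ℝ, E).tangent (TangentBundle 𝓘(ℝ, E) M))) :=
    ((contMDiff_toTM V).contMDiff_tangentMap le_rfl).comp (contMDiff_toTM U)
  have hV := contMDiff_toTM V
  have hVO : ∀ᶠ p in 𝓝 p₀, toTM V p ∈ O := hV.continuous.continuousAt (hO.mem_nhds hvO)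
  have hsrc : ∀ᶠ p in 𝓝 p₀, p ∈ (chartAt E p₀).source := chart_source_mem_nhds E p₀
  have hx (i : Fin k) : ContMDiffAt 𝓘(ℝ, E) 𝓘(ℝ, E × E) ∞
      (fun p ↦ coordT (toTM V p₀) (toTM V p) (X i (toTM V p))) p₀ := by
    have h := (contMDiffAt_totalSpace.1 ((hXs i).contMDiffAt (hO.mem_nhds hvO))).2
    have h' := ContMDiffAt.comp p₀ h hV.contMDiffAt
    refine h'.congr_of_eventuallyEq ?_
    filter_upwards [hsrc] with p hp
    exact coordT_apply hp _
  have hz' : ContMDiffAt 𝓘(ℝ, E) 𝓘(ℝ, E × E) ∞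
      (fun p ↦ coordT (toTM V p₀) (toTM V p) (push V p (U p))) p₀ := by
    refine (contMDiffAt_totalSpace.1 hz.contMDiffAt).2.congr_of_eventuallyEq ?_
    filter_upwards [hsrc] with p hp
    exact coordT_apply hp _
  have hinv (p : M) (hp : p ∈ (chartAt E p₀).source) (hpO : toTM V p ∈ O) :
      (frameMap fun i ↦ coordT (toTM V p₀) (toTM V p) (X i (toTM V p))).IsInvertible :=
    H.frameMap_isInvertible hp (hX _ hpO).1 (hX _ hpO).2
  obtain ⟨e, he⟩ := hinv p₀ (mem_chart_source E p₀) hvO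
  have hF := contMDiffAt_frameMap hx
  -- Inversion of continuous linear maps is smooth at an invertible one.
  have hFi := ContMDiffAt.comp p₀ (he ▸ (contDiffAt_map_inverse (n := ∞) e).contMDiffAt) hF
  have hG := ContMDiffAt.comp p₀
    (ContinuousLinearMap.snd ℝ (Fin k → ℝ) E).contMDiff.contMDiffAt (hFi.clm_apply hz')
  refine (contMDiffAt_section p₀).2 ?_
  refine hG.congr_of_eventuallyEq ?_
  filter_upwards [hsrc, hVO] with p hp hpO
  obtain ⟨c, hc⟩ := H.exists_frameMap_eq (u₀ := toTM V p₀) (u := toTM V p) hp (hX _ hpO).2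
    (push V p (U p))
  refine (coord_apply hp _).symm.trans ?_
  obtain ⟨e', he'⟩ := hinv p hp hpO
  have h : (frameMap fun i ↦ coordT (toTM V p₀) (toTM V p) (X i (toTM V p))).inverse
      (coordT (toTM V p₀) (toTM V p) (push V p (U p))) =
      (c, coord M (toTM V p₀).proj (toTM V p).proj
        (H.connector (toTM V p) (push V p (U p)))) := by
    rw [← hc, ← he', ContinuousLinearMap.inverse_equiv]
    exact e'.symm_apply_apply _
  exact (congrArg Prod.snd h).symm

/-! ### The bijection and its inverse -/

noncomputable section

/-- The covariant derivative of a connection. -/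
def Connection.covariantDerivative (H : Connection E M) (U V : VectorFields E M) :
    VectorFields E M :=
  ⟨fun p ↦ H.connector (toTM V p) (push V p (U p)), H.contMDiff_connector_push U V⟩

end

theorem Connection.isAssociated_covariantDerivative (H : Connection E M) :
    H.IsAssociated H.covariantDerivative :=
  fun _ _ _ ↦ rfl

theorem Connection.IsAssociated.eq_covariantDerivative {H : Connection E M}
    {D : VectorFields E M → VectorFields E M → VectorFields E M} (h : H.IsAssociated D) :
    D = H.covariantDerivative := by
  funext U V
  ext p
  exact h U V p

/-- A connection is recovered from its covariant derivative. -/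
theorem Connection.IsAssociated.reconstruct_eq [T2Space M] {H : Connection E M}
    {D : VectorFields E M → VectorFields E M → VectorFields E M} (h : H.IsAssociated D)
    (u : TangentBundle 𝓘(ℝ, E) M) :
    (H.hor u : Set (TangentSpace 𝓘(ℝ, E).tangent u)) = reconstruct D u := by
  ext z
  constructor
  · intro hz
    obtain ⟨U, hU⟩ := exists_vectorField_eq u.proj u.2
    -- Replacing `u` by `U_p` makes the tangent spaces agree on the nose.
    obtain ⟨p, rfl⟩ : ∃ p, u = toTM U p := ⟨u.proj, by rw [toTM, hU]⟩
    obtain ⟨V, hV⟩ := exists_vectorField_eq p (projDeriv (toTM U p) z)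
    refine ⟨U, V, ?_⟩
    refine congrArg (TotalSpace.mk (toTM U p)) ?_
    change z = push U p (V p) - vertLift (toTM U p) (D V U p)
    rw [h]
    have h1 := H.sub_vertLift_connector_mem (toTM U p) (push U p (V p))
    -- Both vectors are horizontal with the same image under `π_*`, so their difference is also
    -- vertical.
    refine sub_eq_zero.1 (H.eq_zero_of_mem_of_mem ((H.hor _).sub_mem hz h1) ?_)
    change projDeriv (toTM U p) _ = 0
    rw [map_sub, map_sub, projDeriv_vertLift, projDeriv_push, hV, sub_zero, sub_self]
  · rintro ⟨U, V, hUV⟩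
    -- Quantifying over points of `TTM` avoids transport along `U_p = u`.
    have key : ∀ ξ : TangentBundle 𝓘(ℝ, E).tangent (TangentBundle 𝓘(ℝ, E) M),
        ξ = ⟨toTM U u.proj, push U u.proj (V u.proj) -
          vertLift (toTM U u.proj) (D V U u.proj)⟩ → ξ.2 ∈ H.hor ξ.1 := by
      rintro _ rfl
      rw [h]
      exact H.sub_vertLift_connector_mem _ _
    exact key _ hUV

theorem Connection.covariantDerivative_injective [T2Space M] :
    Function.Injective (Connection.covariantDerivative (E := E) (M := M)) := by
  intro H H' h
  ext u z
  have h1 := H.isAssociated_covariantDerivative.reconstruct_eq u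
  rw [h, ← H'.isAssociated_covariantDerivative.reconstruct_eq u] at h1
  exact Set.ext_iff.1 h1 z

noncomputable section

/-- The bijection between connections and covariant derivatives. -/
def equivCovariantDerivative [T2Space M] : Connection E M ≃ NonlinearCovariantDerivative E M :=
  Equiv.ofBijective (fun H ↦ ⟨H.covariantDerivative, H, H.isAssociated_covariantDerivative⟩)
    ⟨fun _ _ h ↦ Connection.covariantDerivative_injective (congrArg Subtype.val h),
      fun ⟨_, H, hH⟩ ↦ ⟨H, Subtype.ext hH.eq_covariantDerivative.symm⟩⟩

end

end

/-! ### Connections from vertical projectors -/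

/-- A section of `End(TTM)` that has constant coefficients in the coordinates at `u₀` is smooth on
the domain of these coordinates. -/
theorem contMDiffOn_endomorphism_of_coordT {u₀ : TangentBundle 𝓘(ℝ, E) M}
    {S : ∀ u : TangentBundle 𝓘(ℝ, E) M,
      TangentSpace 𝓘(ℝ, E).tangent u →L[ℝ] TangentSpace 𝓘(ℝ, E).tangent u} (L : E × E →L[ℝ] E × E)
    (hS : ∀ u : TangentBundle 𝓘(ℝ, E) M, u.proj ∈ (chartAt E u₀.proj).source →
      ∀ z, coordT u₀ u (S u z) = L (coordT u₀ u z)) :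
    ContMDiffOn 𝓘(ℝ, E).tangent (𝓘(ℝ, E).tangent.prod 𝓘(ℝ, E × E →L[ℝ] E × E)) ∞
      (fun u ↦ TotalSpace.mk' (E × E →L[ℝ] E × E)
        (E := fun u : TangentBundle 𝓘(ℝ, E) M ↦
          TangentSpace 𝓘(ℝ, E).tangent u →L[ℝ] TangentSpace 𝓘(ℝ, E).tangent u) u (S u))
      (chartAt (ModelProd E E) u₀).source := by
  let e := trivializationAt (E × E →L[ℝ] E × E)
    (fun u : TangentBundle 𝓘(ℝ, E) M ↦
          TangentSpace 𝓘(ℝ, E).tangent u →L[ℝ] TangentSpace 𝓘(ℝ, E).tangent u) u₀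
  rw [e.contMDiffOn_section_iff (chartAt (ModelProd E E) u₀).open_source
    (fun u hu ↦ ⟨hu, hu⟩)]
  refine contMDiffOn_const (c := L) |>.congr fun u hu ↦ ?_
  have hu' : u ∈ (trivializationAt (E × E) (TangentSpace 𝓘(ℝ, E).tangent) u₀).baseSet := hu
  rw [TangentBundle.mem_chart_source_iff] at hu
  rw [hom_trivializationAt_apply]
  refine ContinuousLinearMap.ext fun y ↦ ?_
  change coordT u₀ u (S u ((trivializationAt (E × E) (TangentSpace 𝓘(ℝ, E).tangent) u₀).symmL
    ℝ u y)) = L y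
  rw [hS u hu, coordT, Trivialization.continuousLinearMapAt_symmL _ hu']

/-- The projectors of `T_u TM` onto the vertical space. -/
def verticalProjectors (u : TangentBundle 𝓘(ℝ, E) M) :
    Set (TangentSpace 𝓘(ℝ, E).tangent u →L[ℝ] TangentSpace 𝓘(ℝ, E).tangent u) :=
  {P | (∀ z, projDeriv u (P z) = 0) ∧ ∀ w, P (vertLift u w) = vertLift u w}

variable (E M) in
/-- Smooth sections of `End(TTM)`. -/
abbrev Endomorphisms :=
  Cₛ^∞⟮𝓘(ℝ, E).tangent; E × E →L[ℝ] E × E, fun u : TangentBundle 𝓘(ℝ, E) M ↦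
    TangentSpace 𝓘(ℝ, E).tangent u →L[ℝ] TangentSpace 𝓘(ℝ, E).tangent u⟯

/-- Both defining conditions are affine in `P`, which permits gluing by a partition of unity. -/
theorem convex_verticalProjectors (u : TangentBundle 𝓘(ℝ, E) M) :
    Convex ℝ (verticalProjectors u) := by
  rintro P ⟨hP, hP'⟩ Q ⟨hQ, hQ'⟩ a b - - hab
  refine ⟨fun z ↦ ?_, fun w ↦ ?_⟩
  · change projDeriv u (a • P z + b • Q z) = 0
    rw [map_add, map_smul, map_smul, hP, hQ, smul_zero, smul_zero, add_zero]
  · change a • P _ + b • Q _ = _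
    rw [hP', hQ', ← add_smul, hab, one_smul]

theorem apply_eq_of_mem_vertical {u : TangentBundle 𝓘(ℝ, E) M}
    {P : TangentSpace 𝓘(ℝ, E).tangent u →L[ℝ] TangentSpace 𝓘(ℝ, E).tangent u}
    (hP : P ∈ verticalProjectors u) {z : TangentSpace 𝓘(ℝ, E).tangent u} (hz : z ∈ vertical u) :
    P z = z := by
  rw [← range_vertLift] at hz
  obtain ⟨w, rfl⟩ := hz
  exact hP.2 w

theorem exists_verticalProjector [FiniteDimensional ℝ E] [SigmaCompactSpace M] [T2Space M] :
    ∃ P : Endomorphisms E M, ∀ u, P u ∈ verticalProjectors u := by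
  have : T2Space (TangentBundle 𝓘(ℝ, E) M) := t2Space_tangentBundle
  have : SigmaCompactSpace (TangentBundle 𝓘(ℝ, E) M) := sigmaCompactSpace_tangentBundle
  refine exists_contMDiffSection_forall_mem_convex_of_local 𝓘(ℝ, E).tangent _
    verticalProjectors convex_verticalProjectors fun u₀ ↦ ?_
  let e := trivializationAt (E × E) (TangentSpace 𝓘(ℝ, E).tangent) u₀
  -- The local projector is `(a, b) ↦ (0, b)` in the chart at `u₀`.
  let S (u : TangentBundle 𝓘(ℝ, E) M) :
      TangentSpace 𝓘(ℝ, E).tangent u →L[ℝ] TangentSpace 𝓘(ℝ, E).tangent u :=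
    (e.symmL ℝ u).comp (((ContinuousLinearMap.inr ℝ E E).comp
      (ContinuousLinearMap.snd ℝ E E)).comp (coordT u₀ u))
  have hS (u : TangentBundle 𝓘(ℝ, E) M) (hu : u.proj ∈ (chartAt E u₀.proj).source)
      (z : TangentSpace 𝓘(ℝ, E).tangent u) : coordT u₀ u (S u z) = (0, (coordT u₀ u z).2) := by
    have hu' : u ∈ e.baseSet := by
      rwa [TangentBundle.trivializationAt_baseSet, TangentBundle.mem_chart_source_iff]
    exact e.continuousLinearMapAt_symmL hu' _
  refine ⟨_, chart_source_mem_nhds (ModelProd E E) u₀, S, contMDiffOn_endomorphism_of_coordT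
    ((ContinuousLinearMap.inr ℝ E E).comp (ContinuousLinearMap.snd ℝ E E)) hS, fun u hu ↦ ?_⟩
  rw [TangentBundle.mem_chart_source_iff] at hu
  refine ⟨fun z ↦ (coord_bijective hu).1 ?_, fun w ↦ (coordT_bijective hu).1 ?_⟩
  · rw [← coordT_fst hu, hS u hu, map_zero]
  · rw [hS u hu, coordT_vertLift hu]

noncomputable section

/-- The connection whose horizontal spaces are the kernels of a field of vertical projectors. -/
def Connection.ofProjector [FiniteDimensional ℝ E] (P : Endomorphisms E M)
    (hP : ∀ u, P u ∈ verticalProjectors u) : Connection E M where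
  hor u := LinearMap.ker (P u).toLinearMap
  isCompl u := by
    have hfix (z) (hz : z ∈ vertical u) : P u z = z := apply_eq_of_mem_vertical (hP u) hz
    rw [isCompl_iff, Submodule.disjoint_def, Submodule.codisjoint_iff_exists_add_eq]
    refine ⟨fun z hz hz' ↦ (hfix z hz').symm.trans hz,
      fun z ↦ ⟨z - P u z, P u z, ?_, (hP u).1 z, sub_add_cancel _ _⟩⟩
    change P u (z - P u z) = 0
    rw [map_sub, hfix _ ((hP u).1 z), sub_self]
  smooth u₀ := by
    let e := trivializationAt (E × E) (TangentSpace 𝓘(ℝ, E).tangent) u₀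
    let b := Module.finBasis ℝ E
    let Z (i : Fin (Module.finrank ℝ E)) (u : TangentBundle 𝓘(ℝ, E) M) :
      TangentSpace 𝓘(ℝ, E).tangent u := e.symm u (b i, 0)
    have hZ (i) : ContMDiffOn 𝓘(ℝ, E).tangent (𝓘(ℝ, E).tangent.prod 𝓘(ℝ, E × E)) ∞
        (fun u ↦ TotalSpace.mk' (E × E) u (Z i u)) e.baseSet := by
      rw [e.contMDiffOn_section_baseSet_iff]
      refine contMDiffOn_const (c := ((b i, 0) : E × E)) |>.congr fun x hx ↦ ?_
      rw [e.apply_mk_symm hx]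
    -- The frame consists of the horizontal parts of the coordinate fields `(b i, 0)`. Removing
    -- vertical parts keeps the first components `b i`, whence independence.
    refine ⟨e.baseSet, e.open_baseSet, FiberBundle.mem_baseSet_trivializationAt' u₀, _,
      fun i u ↦ Z i u - P u (Z i u), fun i ↦ ?_, fun u hu ↦ ?_⟩
    · exact (hZ i).sub_section (P.contMDiff.contMDiffOn.clm_bundle_apply (hZ i))
    · have hu' : u.proj ∈ (chartAt E u₀.proj).source := by
        rwa [← TangentBundle.mem_chart_source_iff]
      have hb (i) : (coordT u₀ u (Z i u - P u (Z i u))).1 = b i := by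
        rw [coordT_fst hu', map_sub, (hP u).1, sub_zero, ← coordT_fst hu', coordT_apply hu',
          e.apply_mk_symm hu]
      have hker (i) : P u (Z i u - P u (Z i u)) = 0 := by
        rw [map_sub, apply_eq_of_mem_vertical (hP u) ((hP u).1 (Z i u)), sub_self]
      constructor
      · refine LinearIndependent.of_comp
          ((ContinuousLinearMap.fst ℝ E E).comp (coordT u₀ u)).toLinearMap ?_
        convert! b.linearIndependent using 1
        exact funext hb
      · refine le_antisymm (Submodule.span_le.2 ?_) fun z hz ↦ ?_
        · rintro _ ⟨i, rfl⟩
          exact hker i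
        · let c := b.repr (coordT u₀ u z).1
          -- With `c` the coordinates of `π_* z`, the difference is vertical, hence fixed by `P`;
          -- being in `ker P`, it is zero.
          have hd : z - ∑ i, c i • (Z i u - P u (Z i u)) ∈ vertical u := by
            refine (coord_bijective hu').1 ?_
            refine (coordT_fst hu' _).symm.trans ?_
            rw [map_zero, map_sub, map_sum, Prod.fst_sub, Prod.fst_sum]
            simp only [map_smul, Prod.smul_fst, hb]
            rw [b.sum_repr, sub_self]
          have hd' : P u (z - ∑ i, c i • (Z i u - P u (Z i u))) = 0 := by
            rw [map_sub, map_sum, show P u z = 0 from hz]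
            simp only [map_smul, hker, smul_zero, Finset.sum_const_zero, sub_zero]
          rw [apply_eq_of_mem_vertical (hP u) hd, sub_eq_zero] at hd'
          rw [Submodule.mem_span_range_iff_exists_fun]
          exact ⟨c, hd'.symm⟩

end

/-- Since `P = 𝒥 ∘ κ`, a change of `P` can be read off as a change of `κ`. -/
theorem Connection.vertLift_connector_ofProjector [FiniteDimensional ℝ E] (P : Endomorphisms E M)
    (hP : ∀ u, P u ∈ verticalProjectors u) (u : TangentBundle 𝓘(ℝ, E) M)
    (z : TangentSpace 𝓘(ℝ, E).tangent u) :
    vertLift u ((Connection.ofProjector P hP).connector u z) = P u z := by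
  let H := Connection.ofProjector P hP
  obtain ⟨w, hw⟩ : P u z ∈ LinearMap.range (vertLift u).toLinearMap := by
    rw [range_vertLift]
    exact (hP u).1 z
  have hw' : vertLift u w = P u z := hw
  rw [← hw']
  refine congrArg (vertLift u) (H.connector_eq_of_sub_mem ?_)
  change P u (z - vertLift u w) = 0
  rw [map_sub, (hP u).2, hw', sub_self]

/-! ### A nonlinear covariant derivative -/

/-- The vertical endomorphism `𝒥 ∘ π_*` of `TTM` is smooth. -/
theorem exists_verticalEndomorphism :
    ∃ N : Endomorphisms E M, ∀ u z, N u z = vertLift u (projDeriv u z) := by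
  refine ⟨⟨fun u ↦ (vertLift u).comp (projDeriv u), fun u ↦ ?_⟩, fun _ _ ↦ rfl⟩
  refine (contMDiffOn_endomorphism_of_coordT (u₀ := u) ((ContinuousLinearMap.inr ℝ E E).comp
    (ContinuousLinearMap.fst ℝ E E)) fun v hv z ↦ ?_).contMDiffAt (chart_source_mem_nhds _ u)
  change coordT u v (vertLift v (projDeriv v z)) = (0, (coordT u v z).1)
  rw [coordT_vertLift hv, coordT_fst hv]

/-- On a Hausdorff manifold of positive dimension, there is a smooth function with a nonzero
derivative. -/
theorem exists_mfderiv_ne_zero [FiniteDimensional ℝ E] [Nontrivial E] [T2Space M] (p : M) :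
    ∃ f : M → ℝ, ContMDiff 𝓘(ℝ, E) 𝓘(ℝ, ℝ) ∞ f ∧
      ∃ v : TangentSpace 𝓘(ℝ, E) p, mfderiv 𝓘(ℝ, E) 𝓘(ℝ, ℝ) f p v ≠ 0 := by
  obtain ⟨g⟩ : Nonempty (SmoothBumpFunction 𝓘(ℝ, E) p) := inferInstance
  obtain ⟨y, hy⟩ := exists_ne (0 : E)
  obtain ⟨l, hl⟩ := SeparatingDual.exists_ne_zero (R := ℝ) hy
  have hp := mem_chart_source E p
  obtain ⟨v, rfl⟩ := (coord_bijective hp).2 y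
  -- Near `p` the bump function is `1`, so the derivative there is `l` in coordinates, and `v` was
  -- chosen with `l (coord v) ≠ 0`.
  refine ⟨fun x ↦ g x • l (extChartAt 𝓘(ℝ, E) p x), g.contMDiff_smul ?_, v, ?_⟩
  · exact l.contMDiff.comp_contMDiffOn contMDiffOn_extChartAt
  · have h : HasMFDerivAt 𝓘(ℝ, E) 𝓘(ℝ, ℝ) (l ∘ extChartAt 𝓘(ℝ, E) p) p
        (l.comp (coord (E := E) M p p)) :=
      l.hasMFDerivAt.comp p (hasMFDerivAt_extChartAt_coord hp)
    have h' := h.congr_of_eventuallyEq (f₁ := fun x ↦ g x • l (extChartAt 𝓘(ℝ, E) p x)) (by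
      filter_upwards [g.eventuallyEq_one] with x hx
      simp [hx])
    rw [h'.mfderiv]
    exact hl

/-- If the derivatives from `P` and `P + (df)² 𝒥 π_*` were both linear in `V`, so would be their
difference `(df V)² U`, which scales quadratically. -/
theorem exists_not_isLinearMap [FiniteDimensional ℝ E] [Nontrivial E] [SigmaCompactSpace M]
    [T2Space M] [Nonempty M] : ∃ (D : NonlinearCovariantDerivative E M)
        (U : VectorFields E M), ¬ IsLinearMap ℝ (D.1 U) := by
  obtain ⟨p⟩ := ‹Nonempty M›
  obtain ⟨f, hf, v, hv⟩ := exists_mfderiv_ne_zero (E := E) p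
  obtain ⟨P, hP⟩ := exists_verticalProjector (E := E) (M := M)
  obtain ⟨N, hN⟩ := exists_verticalEndomorphism (E := E) (M := M)
  let df (u : TangentBundle 𝓘(ℝ, E) M) : ℝ := (tangentMap 𝓘(ℝ, E) 𝓘(ℝ, ℝ) f u).2
  let q (u : TangentBundle 𝓘(ℝ, E) M) : ℝ := df u ^ 2
  have hdf : ContMDiff 𝓘(ℝ, E).tangent 𝓘(ℝ, ℝ) ∞ df :=
    ContMDiff.comp (contMDiff_snd_tangentBundle_modelSpace ℝ 𝓘(ℝ, ℝ)) (hf.contMDiff_tangentMap le_rfl)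
  have hq : ContMDiff 𝓘(ℝ, E).tangent 𝓘(ℝ, ℝ) ∞ q := hdf.pow 2
  -- `𝒥 ∘ π_*` takes vertical values and kills vertical vectors, so any multiple of it may be added
  -- to a vertical projector.
  let P' : Endomorphisms E M := ⟨fun u ↦ P u + q u • N u,
    P.contMDiff.add_section (hq.smul_section N.contMDiff)⟩
  have hP'_apply (u z) : P' u z = P u z + q u • vertLift u (projDeriv u z) := by
    rw [← hN]
    rfl
  have hP' (u) : P' u ∈ verticalProjectors u := by
    refine ⟨fun z ↦ ?_, fun w ↦ ?_⟩
    · rw [hP'_apply, map_add, (hP u).1, map_smul, projDeriv_vertLift, smul_zero, add_zero]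
    · rw [hP'_apply, (hP u).2, projDeriv_vertLift, map_zero, smul_zero, add_zero]
  let H := Connection.ofProjector P hP
  let H' := Connection.ofProjector P' hP'
  have hκ (u z) : H'.connector u z = H.connector u z + q u • projDeriv u z := by
    apply vertLift_injective u
    rw [map_add, map_smul, Connection.vertLift_connector_ofProjector,
      Connection.vertLift_connector_ofProjector, hP'_apply]
  have hD (U V : VectorFields E M) : H'.covariantDerivative U V p =
      H.covariantDerivative U V p + q (toTM V p) • U p := by
    have h := hκ (toTM V p) (push V p (U p))
    rwa [projDeriv_push] at h
  obtain ⟨U, hU⟩ := exists_vectorField_eq p v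
  by_contra! hlin
  have h := hlin ⟨H.covariantDerivative, H, H.isAssociated_covariantDerivative⟩ U
  have h' := hlin ⟨H'.covariantDerivative, H', H'.isAssociated_covariantDerivative⟩ U
  have h2 : H.covariantDerivative U ((2 : ℝ) • U) p = (2 : ℝ) • H.covariantDerivative U U p :=
    congrArg (fun W : VectorFields E M ↦ W p) (h.map_smul 2 U)
  have h2' : H'.covariantDerivative U ((2 : ℝ) • U) p = (2 : ℝ) • H'.covariantDerivative U U p :=
    congrArg (fun W : VectorFields E M ↦ W p) (h'.map_smul 2 U)
  have hq2 : q (toTM ((2 : ℝ) • U) p) = 4 * q (toTM U p) := by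
    have h : df (toTM ((2 : ℝ) • U) p) = 2 * df (toTM U p) :=
      map_smul (mfderiv 𝓘(ℝ, E) 𝓘(ℝ, ℝ) f p) (2 : ℝ) (U p)
    change df _ ^ 2 = 4 * df _ ^ 2
    rw [h]
    ring
  have hqU : q (toTM U p) ≠ 0 := by
    refine pow_ne_zero 2 ?_
    change mfderiv 𝓘(ℝ, E) 𝓘(ℝ, ℝ) f p (U p) ≠ 0
    rwa [hU]
  have hv0 : v ≠ 0 := fun h ↦ hv (by rw [h, map_zero])
  -- Comparing `V = 2U` with `V = U` leaves `(4 q - 2 q) v = 0`, where `q = (df v)² ≠ 0` and `v ≠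
  -- 0`.
  rw [hD, hD, h2, hq2, smul_add, add_right_inj, smul_smul, hU, ← sub_eq_zero, ← sub_smul,
    smul_eq_zero, or_iff_left hv0] at h2'
  exact hqU (by linarith)

end NonlinearConnection

theorem mainTheorem2 {E : Type*} [NormedAddCommGroup E] [NormedSpace ℝ E] [FiniteDimensional ℝ E]
    {M : Type*} [TopologicalSpace M] [ChartedSpace E M] [IsManifold 𝓘(ℝ, E) ∞ M]
    [ConnectedSpace M] [ParacompactSpace M] [T2Space M] :
    ∃ Φ : NonlinearConnection.Connection E M ≃ NonlinearConnection.NonlinearCovariantDerivative E M,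
      (∀ H : NonlinearConnection.Connection E M, H.IsAssociated (Φ H).1) ∧
      (∀ (D : NonlinearConnection.NonlinearCovariantDerivative E M) (u : TangentBundle 𝓘(ℝ, E) M),
        ((Φ.symm D).hor u : Set (TangentSpace 𝓘(ℝ, E).tangent u)) =
          NonlinearConnection.reconstruct D.1 u) ∧
      (∀ D : NonlinearConnection.NonlinearCovariantDerivative E M,
        NonlinearConnection.IsTensorialInDirection D.1) ∧
      (Nontrivial E → ∃ (D : NonlinearConnection.NonlinearCovariantDerivative E M)
        (U : NonlinearConnection.VectorFields E M), ¬ IsLinearMap ℝ (D.1 U)) := by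
  have : LocallyCompactSpace M := Manifold.locallyCompact_of_finiteDimensional 𝓘(ℝ, E)
  have : SigmaCompactSpace M := sigmaCompactSpace_of_connected_of_paracompact
  let Φ := NonlinearConnection.equivCovariantDerivative (E := E) (M := M)
  have hΦ (H : NonlinearConnection.Connection E M) : H.IsAssociated (Φ H).1 :=
    H.isAssociated_covariantDerivative
  refine ⟨Φ, hΦ, fun D u ↦ ?_, fun D ↦ ?_, fun _ ↦ NonlinearConnection.exists_not_isLinearMap⟩
  · have h := hΦ (Φ.symm D)
    rw [Φ.apply_symm_apply] at h
    exact h.reconstruct_eq u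
  · obtain ⟨H, hH⟩ := D.2
    exact hH.isTensorialInDirection
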